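/- Let $(Z_k,E_k)_{k\in\mathbb Z}$ be a random sequence in $\mathbb R\times\mathbb R$ with law $\mathbb P$ such that: (A1) the sequence is stationary and ergodic with respect to shifts; (A2) $\mathbb E[Z_0]$ is finite; (A3) for every $\ell\in\mathbb Z\setminus\{0\}$, $\mathbb P(\omega=\tau_\ell\omega)=0$, where $\omega=(Z_k,E_k)_{k}$ and $\tau_\ell\omega=(Z_{k+\ell},E_{k+\ell})_{k}$; (A4) there is a constant $d>0$ with $\mathbb P(Z_0\ge d)=1$. Let $(x_k)_{k\in\mathbb Z}$ be the points of $\mathbb R$ with $x_0=0$ and $x_{k+1}-x_k=Z_k$, let $u:\mathbb R\times\mathbb R\to\mathbb R$ be bounded and symmetric, and let $\lambda\in(0,1)$. Given the environment $\omega$, let $(X_t^{\omega,\lambda})_{t\ge 0}$ be the continuous-time random walk on $\{x_k\}$ started at the origin which jumps from $x_i$ to $x_j\neq x_i$ at rate $$r^\lambda_{x_i,x_j}(\omega)=\exp\{-|x_i-x_j|+\lambda(x_j-x_i)-u(E_i,E_j)\}.$$ Then for $\mathbb P$-almost every environment $\omega$ the walk is transient to the right: $$\lim_{t\to\infty}X_t^{\omega,\lambda}=+\infty\quad\text{almost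 surely.}$$ -/

import Mathlib

open MeasureTheory ProbabilityTheory Filter
open scoped ENNReal

namespace MottWalk

noncomputable section

/-- An environment, coded by the doubly infinite sequence `k ↦ (Z k, E k)` of interpoint distances
and energy marks. -/
abbrev Env : Type := ℤ → ℝ × ℝ

/-- The interpoint distance `Z k = x (k + 1) - x k`. -/
def gap (ω : Env) (k : ℤ) : ℝ := (ω k).1

/-- The energy mark `E k` of the point `x k`. -/
def mark (ω : Env) (k : ℤ) : ℝ := (ω k).2

/-- The shift by `l` of the sequence `(Z k, E k)`. -/
def shift (l : ℤ) (ω : Env) : Env := fun k => ω (k + l)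

/-- The position of the `k`-th point of the environment, with `x 0 = 0`. -/
def point (ω : Env) (k : ℤ) : ℝ :=
  ∑ i ∈ Finset.Ico 0 k, gap ω i - ∑ i ∈ Finset.Ico k 0, gap ω i

theorem point_zero (ω : Env) : point ω 0 = 0 := by
  simp [point]

theorem point_add_one_sub (ω : Env) (k : ℤ) : point ω (k + 1) - point ω k = gap ω k := by
  unfold point
  rcases le_or_gt 0 k with h | h
  · have h1 : Finset.Ico (0 : ℤ) (k + 1) = insert k (Finset.Ico 0 k) := by
      ext i; simp only [Finset.mem_insert, Finset.mem_Ico]; omega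
    rw [h1, Finset.sum_insert (by simp), Finset.Ico_eq_empty_of_le h,
      Finset.Ico_eq_empty_of_le (by omega : (0 : ℤ) ≤ k + 1)]
    simp
  · have h1 : Finset.Ico k (0 : ℤ) = insert k (Finset.Ico (k + 1) 0) := by
      ext i; simp only [Finset.mem_insert, Finset.mem_Ico]; omega
    rw [h1, Finset.sum_insert (by simp), Finset.Ico_eq_empty_of_le (le_of_lt h),
      Finset.Ico_eq_empty_of_le (by omega : k + 1 ≤ (0 : ℤ))]
    simp

/-- The rate of a jump from `x i` to `x j` in the field `lam`; it is `0` for `i = j`. -/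
def rate (u : ℝ → ℝ → ℝ) (lam : ℝ) (ω : Env) (i j : ℤ) : ℝ :=
  if i = j then 0
  else Real.exp (-|point ω i - point ω j| + lam * (point ω j - point ω i)
    - u (mark ω i) (mark ω j))

/-- The total jump rate out of `x i`. -/
def totalRate (u : ℝ → ℝ → ℝ) (lam : ℝ) (ω : Env) (i : ℤ) : ℝ≥0∞ :=
  ∑' j, ENNReal.ofReal (rate u lam ω i j)

open Classical in
/-- The law of the label of the point reached by a jump from `x i`: it gives `j` the probability
`rate i j / totalRate i`. Where the total rate is infinite (or zero) there is no such law, and an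
arbitrary default value is taken. -/
def jumpLaw (u : ℝ → ℝ → ℝ) (lam : ℝ) (ω : Env) (i : ℤ) : PMF ℤ :=
  if h : totalRate u lam ω i ≠ 0 ∧ totalRate u lam ω i ≠ ∞ then
    PMF.normalize (fun j => ENNReal.ofReal (rate u lam ω i j)) h.1 h.2
  else PMF.pure i

/-- The transition kernel of the jump chain, on the labels of the points. -/
def jumpKernel (u : ℝ → ℝ → ℝ) (lam : ℝ) (ω : Env) : Kernel ℤ ℤ :=
  Kernel.ofFunOfCountable fun i => (jumpLaw u lam ω i).toMeasure

instance (u : ℝ → ℝ → ℝ) (lam : ℝ) (ω : Env) : IsMarkovKernel (jumpKernel u lam ω) :=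
  ⟨fun i => inferInstanceAs (IsProbabilityMeasure (jumpLaw u lam ω i).toMeasure)⟩

/-- The law, on sequences of labels, of the jump chain started at label `0`, i.e. at the origin:
given the past, step `n + 1` is distributed according to the jump kernel at the `n`-th label. -/
def chainLaw (u : ℝ → ℝ → ℝ) (lam : ℝ) (ω : Env) : Measure (ℕ → ℤ) :=
  Kernel.trajMeasure (X := fun _ => ℤ) (Measure.dirac 0) fun n =>
    (jumpKernel u lam ω).comap (fun h : (_ : Finset.Iic n) → ℤ => h ⟨n, Finset.mem_Iic.2 le_rfl⟩)
      (measurable_pi_apply _)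

/-- The law of a sequence of independent exponential clocks with mean `1`. -/
def clockLaw : Measure (ℕ → ℝ) := Measure.infinitePi fun _ => expMeasure 1

/-- The quenched law: the jump chain and an independent sequence of exponential clocks. -/
def quenchedLaw (u : ℝ → ℝ → ℝ) (lam : ℝ) (ω : Env) : Measure ((ℕ → ℤ) × (ℕ → ℝ)) :=
  (chainLaw u lam ω).prod clockLaw

/-- The time of the `n`-th jump. The holding time at the `k`-th visited point `x (Y k)` is the
`k`-th clock divided by the total rate out of that point; so, given the chain, it is exponential
with parameter this total rate. -/
def jumpTime (u : ℝ → ℝ → ℝ) (lam : ℝ) (ω : Env) (p : (ℕ → ℤ) × (ℕ → ℝ)) (n : ℕ) : ℝ :=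
  ∑ k ∈ Finset.range n, p.2 k / (totalRate u lam ω (p.1 k)).toReal

/-- The number of jumps up to time `t`. -/
def numJumps (u : ℝ → ℝ → ℝ) (lam : ℝ) (ω : Env) (p : (ℕ → ℤ) × (ℕ → ℝ)) (t : ℝ) : ℕ :=
  sSup {n : ℕ | jumpTime u lam ω p n ≤ t}

/-- The position at time `t` of the biased Mott random walk in the environment `ω`. -/
def walk (u : ℝ → ℝ → ℝ) (lam : ℝ) (ω : Env) (p : (ℕ → ℤ) × (ℕ → ℝ)) (t : ℝ) : ℝ :=
  point ω (p.1 (numJumps u lam ω p t))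

end

end MottWalk

/-! Fix an environment whose gaps are all at least `d`. The bias is a gradient, so the jump chain is
reversible: it is the random walk on the network whose edge between `i` and `j` has conductance
exp(λ(x_i + x_j) - |x_i - x_j| - u(E_i, E_j)). The path 0, 1, 2, ... has finite resistance R
(`resistance_ne_top`): x_k grows at least linearly, while almost surely Z_k = o(k), because Z_0 is
integrable and the gaps are identically distributed (`ae_eventually_gap_le`). A path of finite
resistance to infinity bounds the expected number of visits to y by 2 R w(y) (`tsum_occProb_le`);
this is Cauchy-Schwarz against the Dirichlet energy of the Green function. The weight w is summable
over each left half-line, so each is visited finitely often and the chain tends to the right. The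
total rates are bounded, so there is no explosion and the conclusion passes to continuous time. -/

namespace ReversibleChain

/-! ### Green function bounds for reversible chains. -/

open Classical in
/-- The probability of being at `o` at time `n` for the chain started at `y`. -/
noncomputable def hitProb {S : Type*} (p : S → S → ℝ≥0∞) (o : S) : ℕ → S → ℝ≥0∞
  | 0, y => if y = o then 1 else 0
  | n + 1, y => ∑' z, p y z * hitProb p o n z

open Classical in
/-- The probability of being at `y` at time `n` for the chain started at `o`. -/
noncomputable def occProb {S : Type*} (p : S → S → ℝ≥0∞) (o : S) : ℕ → S → ℝ≥0∞
  | 0, y => if y = o then 1 else 0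
  | n + 1, y => ∑' z, occProb p o n z * p z y

/-- The expected number of visits to `o` before time `N` for the chain started at `y`. -/
noncomputable def green {S : Type*} (p : S → S → ℝ≥0∞) (o : S) (N : ℕ) (y : S) : ℝ≥0∞ :=
  ∑ n ∈ Finset.range N, hitProb p o n y

variable {S : Type*} {p : S → S → ℝ≥0∞} {w : S → ℝ≥0∞} {o : S}

/-- Time reversal of n-step paths. -/
theorem weight_mul_hitProb (hrev : ∀ x y, w x * p x y = w y * p y x) (n : ℕ) (y : S) :
    w y * hitProb p o n y = w o * occProb p o n y := by
  induction n generalizing y with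
  | zero => by_cases h : y = o <;> simp [hitProb, occProb, h]
  | succ n ih =>
    simp only [hitProb, occProb, ← ENNReal.tsum_mul_left]
    refine tsum_congr fun z => ?_
    rw [← mul_assoc, hrev, mul_right_comm, ih, mul_assoc]

theorem tsum_occProb (hp : ∀ x, ∑' y, p x y = 1) (n : ℕ) : ∑' y, occProb p o n y = 1 := by
  induction n with
  | zero => simp [occProb]
  | succ n ih =>
    simp only [occProb]
    rw [ENNReal.tsum_comm]
    simp [ENNReal.tsum_mul_left, hp, ih]

theorem hitProb_le_one (hp : ∀ x, ∑' y, p x y = 1) (n : ℕ) (y : S) : hitProb p o n y ≤ 1 := by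
  induction n generalizing y with
  | zero => by_cases h : y = o <;> simp [hitProb, h]
  | succ n ih =>
    calc ∑' z, p y z * hitProb p o n z ≤ ∑' z, p y z * 1 := by gcongr; exact ih _
      _ = 1 := by simp [hp]

theorem green_le (hp : ∀ x, ∑' y, p x y = 1) (N : ℕ) (y : S) : green p o N y ≤ N := by
  calc green p o N y ≤ ∑ n ∈ Finset.range N, 1 := Finset.sum_le_sum fun n _ => hitProb_le_one hp n y
    _ = N := by simp

theorem green_ne_top (hp : ∀ x, ∑' y, p x y = 1) (N : ℕ) (y : S) : green p o N y ≠ ∞ :=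
  ne_top_of_le_ne_top (ENNReal.natCast_ne_top N) (green_le hp N y)

theorem tsum_mul_green (N : ℕ) (y : S) :
    ∑' z, p y z * green p o N z = ∑ n ∈ Finset.range N, hitProb p o (n + 1) y := by
  simp only [green, Finset.mul_sum, hitProb]
  exact Summable.tsum_finsetSum fun _ _ => ENNReal.summable

theorem green_succ (N : ℕ) (y : S) :
    green p o (N + 1) y = ∑' z, p y z * green p o N z + hitProb p o 0 y := by
  rw [tsum_mul_green, green, Finset.sum_range_succ']

/-- The Poisson equation for the truncated Green function: g - Pg = δ_o minus a nonnegative error.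
-/
theorem green_add_hitProb (N : ℕ) (y : S) :
    green p o N y + hitProb p o N y = ∑' z, p y z * green p o N z + hitProb p o 0 y := by
  rw [← green_succ, green, green, Finset.sum_range_succ]

/-- Maximum principle: off `o`, one step averages the previous Green function. -/
theorem green_le_green_self (hp : ∀ x, ∑' y, p x y = 1) (N : ℕ) (y : S) :
    green p o N y ≤ green p o N o := by
  induction N generalizing y with
  | zero => simp [green]
  | succ N ih =>
    by_cases h : y = o
    · rw [h]
    · rw [green_succ, hitProb, if_neg h, add_zero]
      calc ∑' z, p y z * green p o N z ≤ ∑' z, p y z * green p o N o := by gcongr; exact ih _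
        _ = green p o N o := by rw [ENNReal.tsum_mul_right, hp, one_mul]
        _ ≤ green p o (N + 1) o := by
          rw [green, green, Finset.sum_range_succ]; exact le_self_add

theorem tsum_weight_mul_green (hp : ∀ x, ∑' y, p x y = 1)
    (hrev : ∀ x y, w x * p x y = w y * p y x) (N : ℕ) :
    ∑' y, w y * green p o N y = w o * N := by
  simp only [green, Finset.mul_sum, weight_mul_hitProb hrev]
  rw [Summable.tsum_finsetSum fun _ _ => ENNReal.summable]
  simp [ENNReal.tsum_mul_left, tsum_occProb hp, mul_comm]

theorem ofReal_sub_sq_add {a b : ℝ≥0∞} (ha : a ≠ ∞) (hb : b ≠ ∞) :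
    ENNReal.ofReal ((a.toReal - b.toReal) ^ 2) + 2 * (a * b) = a * a + b * b := by
  lift a to NNReal using ha
  lift b to NNReal using hb
  rw [show (2 * ((a : ℝ≥0∞) * b)) = ENNReal.ofReal (2 * (a * b)) by
      rw [ENNReal.ofReal_mul (by norm_num), ENNReal.ofReal_mul (by positivity)]; simp,
    show (a * a + b * b : ℝ≥0∞) = ENNReal.ofReal (a * a + b * b) by
      rw [ENNReal.ofReal_add (by positivity) (by positivity),
        ENNReal.ofReal_mul (by positivity), ENNReal.ofReal_mul (by positivity)]; simp,
    ← ENNReal.ofReal_add (by positivity) (by positivity)]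
  congr 1
  simp only [ENNReal.coe_toReal]
  ring

/-- The Dirichlet energy of the truncated Green function is at most `2 w(o) G(o)`. -/
theorem energy_green_le (hp : ∀ x, ∑' y, p x y = 1)
    (hrev : ∀ x y, w x * p x y = w y * p y x) (hw : w o ≠ ∞) (N : ℕ) :
    ∑' x, ∑' y, w x * p x y *
      ENNReal.ofReal (((green p o N x).toReal - (green p o N y).toReal) ^ 2) ≤
      2 * (w o * green p o N o) := by
  set g := green p o N with hg
  have hgt : ∀ x, g x ≠ ∞ := green_ne_top hp N
  set E := ∑' x, ∑' y, w x * p x y * ENNReal.ofReal (((g x).toReal - (g y).toReal) ^ 2)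
  set A := ∑' x, ∑' y, w x * p x y * (g x * g y)
  set Q := ∑' x, w x * (g x * g x)
  -- Truncation at `N` is what makes Q finite, so that 2A can be cancelled at the end.
  have hQ : Q ≠ ∞ := by
    refine ne_top_of_le_ne_top (b := (w o * N) * N) (by finiteness) ?_
    rw [← tsum_weight_mul_green hp hrev N, ← ENNReal.tsum_mul_right]
    refine ENNReal.tsum_le_tsum fun x => ?_
    rw [← mul_assoc]
    gcongr
    exact green_le hp N x
  have h1 : ∑' x, ∑' y, w x * p x y * (g x * g x) = Q := by
    refine tsum_congr fun x => ?_
    rw [ENNReal.tsum_mul_right, ENNReal.tsum_mul_left, hp, mul_one]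
  have h2 : ∑' x, ∑' y, w x * p x y * (g y * g y) = Q := by
    rw [ENNReal.tsum_comm, ← h1]
    exact tsum_congr fun x => tsum_congr fun y => by rw [hrev]
  have hE : E + 2 * A = Q + Q := by
    conv_rhs => rw [← h1]; arg 2; rw [h1, ← h2]
    rw [← ENNReal.tsum_mul_left, ← ENNReal.tsum_add, ← ENNReal.tsum_add]
    refine tsum_congr fun x => ?_
    rw [← ENNReal.tsum_mul_left, ← ENNReal.tsum_add, ← ENNReal.tsum_add]
    refine tsum_congr fun y => ?_
    rw [← mul_add, ← ofReal_sub_sq_add (hgt x) (hgt y)]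
    ring
  have hA : A = ∑' x, w x * g x * ∑' y, p x y * g y := by
    refine tsum_congr fun x => ?_
    rw [← ENNReal.tsum_mul_left]
    exact tsum_congr fun y => by ring
  -- The inequality g ≤ Pg + δ_o, summed against w g.
  have hQA : Q ≤ A + w o * g o := by
    have h3 : ∑' x, w x * g x * hitProb p o 0 x = w o * g o := by
      rw [tsum_eq_single o fun x hx => by simp [hitProb, hx]]
      simp [hitProb]
    rw [← h3, hA, ← ENNReal.tsum_add]
    refine ENNReal.tsum_le_tsum fun x => ?_
    rw [← mul_add, ← green_add_hitProb, ← mul_assoc]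
    gcongr
    exact le_self_add
  have hAt : 2 * A ≠ ∞ := by
    have : 2 * A ≤ Q + Q := hE ▸ le_add_self
    exact ne_top_of_le_ne_top (by finiteness) this
  refine (ENNReal.add_le_add_iff_right hAt).1 ?_
  calc E + 2 * A = Q + Q := hE
    _ ≤ (A + w o * g o) + (A + w o * g o) := by gcongr
    _ = 2 * (w o * g o) + 2 * A := by ring

/-- Along the path w g is summable, and w ≥ 1/R there because p ≤ 1. -/
theorem tendsto_green_path (hp : ∀ x, ∑' y, p x y = 1)
    (hrev : ∀ x y, w x * p x y = w y * p y x) (hw : ∀ x, w x ≠ ∞) {v : ℕ → S}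
    (hv : Function.Injective v) (hR : ∑' k, (w (v k) * p (v k) (v (k + 1)))⁻¹ ≠ ∞) (N : ℕ) :
    Tendsto (fun k => green p o N (v k)) atTop (nhds 0) := by
  set R := ∑' k, (w (v k) * p (v k) (v (k + 1)))⁻¹
  have hsum : ∑' k, w (v k) * green p o N (v k) ≠ ∞ := by
    refine ne_top_of_le_ne_top (b := w o * N) (ENNReal.mul_ne_top (hw o) (by simp)) ?_
    rw [← tsum_weight_mul_green hp hrev N]
    exact ENNReal.tsum_comp_le_tsum_of_injective hv _
  have ht := ENNReal.tendsto_atTop_zero_of_tsum_ne_top hsum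
  have ht' := ENNReal.Tendsto.const_mul (a := R) ht (Or.inr hR)
  rw [mul_zero] at ht'
  refine tendsto_of_tendsto_of_tendsto_of_le_of_le tendsto_const_nhds ht' (fun _ => zero_le)
    fun k => ?_
  have h1 : (w (v k))⁻¹ ≤ R := by
    refine le_trans ?_ (ENNReal.le_tsum k)
    gcongr
    calc w (v k) * p (v k) (v (k + 1)) ≤ w (v k) * 1 := by
          gcongr; rw [← hp (v k)]; exact ENNReal.le_tsum _
      _ = w (v k) := mul_one _
  have h0 : w (v k) ≠ 0 := fun h => hR (top_le_iff.1 (by simpa [h] using h1))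
  have h2 : 1 ≤ R * w (v k) := by
    calc 1 = (w (v k))⁻¹ * w (v k) := (ENNReal.inv_mul_cancel h0 (hw _)).symm
      _ ≤ _ := by gcongr
  calc green p o N (v k) = 1 * green p o N (v k) := (one_mul _).symm
    _ ≤ R * w (v k) * green p o N (v k) := by gcongr
    _ = _ := by rw [mul_assoc]

/-- Cauchy-Schwarz along a path of finite resistance bounds the Green function. -/
theorem green_self_le (hp : ∀ x, ∑' y, p x y = 1)
    (hrev : ∀ x y, w x * p x y = w y * p y x) (hw : ∀ x, w x ≠ ∞) {v : ℕ → S}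
    (hv : Function.Injective v) (hv0 : v 0 = o)
    (hR : ∑' k, (w (v k) * p (v k) (v (k + 1)))⁻¹ ≠ ∞) (N : ℕ) :
    green p o N o ≤ (∑' k, (w (v k) * p (v k) (v (k + 1)))⁻¹) * (2 * w o) := by
  set c : ℕ → ℝ≥0∞ := fun k => w (v k) * p (v k) (v (k + 1)) with hc
  set R := ∑' k, (c k)⁻¹ with hRdef
  set g := green p o N with hg
  have hgt : ∀ x, g x ≠ ∞ := green_ne_top hp N
  have hp1 : ∀ x y, p x y ≤ 1 := fun x y => hp x ▸ ENNReal.le_tsum y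
  have hct : ∀ k, c k ≠ ∞ := fun k =>
    ENNReal.mul_ne_top (hw _) (ne_top_of_le_ne_top ENNReal.one_ne_top (hp1 _ _))
  have hc0 : ∀ k, c k ≠ 0 := fun k h => by
    have := ENNReal.ne_top_of_tsum_ne_top hR k
    simp [h] at this
  have hE : ∑' k, c k * ENNReal.ofReal (((g (v k)).toReal - (g (v (k + 1))).toReal) ^ 2) ≤
      2 * (w o * g o) := by
    refine le_trans ?_ (energy_green_le hp hrev (hw o) N)
    rw [← ENNReal.tsum_prod]
    -- The path uses each edge at most once, so its energy is part of the total energy.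
    refine le_trans ?_ (ENNReal.tsum_comp_le_tsum_of_injective
      (f := fun k => (v k, v (k + 1))) (fun i j h => hv (Prod.ext_iff.1 h).1) _)
    exact le_rfl
  have hEt : 2 * (w o * g o) ≠ ∞ :=
    ENNReal.mul_ne_top (by simp) (ENNReal.mul_ne_top (hw o) (hgt o))
  have hCS : ∀ M, ((g o).toReal - (g (v M)).toReal) ^ 2 ≤ R.toReal * (2 * (w o * g o)).toReal := by
    intro M
    rw [← hv0, ← Finset.sum_range_sub' (fun k => (g (v k)).toReal) M, hv0]
    refine (Finset.sum_sq_le_sum_mul_sum_of_sq_le_mul _ (f := fun k => ((c k)⁻¹).toReal)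
      (g := fun k => (c k * ENNReal.ofReal
        (((g (v k)).toReal - (g (v (k + 1))).toReal) ^ 2)).toReal)
      (fun _ _ => ENNReal.toReal_nonneg) (fun _ _ => ENNReal.toReal_nonneg) ?_).trans ?_
    · intro k _
      refine le_of_eq ?_
      rw [← ENNReal.toReal_mul, ← mul_assoc, ENNReal.inv_mul_cancel (hc0 k) (hct k), one_mul,
        ENNReal.toReal_ofReal (sq_nonneg _)]
    · rw [← ENNReal.toReal_sum fun k _ => ENNReal.ne_top_of_tsum_ne_top hR k,
        ← ENNReal.toReal_sum fun k _ => ENNReal.mul_ne_top (hct k) ENNReal.ofReal_ne_top]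
      refine mul_le_mul ?_ ?_ ENNReal.toReal_nonneg ENNReal.toReal_nonneg
      · exact ENNReal.toReal_mono hR (ENNReal.sum_le_tsum _)
      · exact ENNReal.toReal_mono hEt ((ENNReal.sum_le_tsum _).trans hE)
  have hlim : ((g o).toReal - 0) ^ 2 ≤ R.toReal * (2 * (w o * g o)).toReal := by
    have h0 := (ENNReal.tendsto_toReal ENNReal.zero_ne_top).comp
      (tendsto_green_path (o := o) hp hrev hw hv hR N)
    exact le_of_tendsto' ((tendsto_const_nhds.sub h0).pow 2) hCS
  rw [← ENNReal.toReal_mul, sub_zero, ← ENNReal.toReal_pow,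
    ENNReal.toReal_le_toReal (ENNReal.pow_ne_top (hgt o)) (ENNReal.mul_ne_top hR hEt)] at hlim
  -- Now g(o)² ≤ 2 R w(o) g(o) with g(o) finite; dividing by g(o) leaves a bound independent of `N`.
  by_cases h0 : g o = 0
  · simp [h0]
  · refine (ENNReal.mul_le_mul_iff_left h0 (hgt o)).1 ?_
    calc g o * g o = g o ^ 2 := (sq _).symm
      _ ≤ _ := hlim
      _ = _ := by ring

/-- The expected number of visits to `y` is at most `2 R w(y)`, where `R` is the resistance of the
path `v` from the starting point to infinity. -/
theorem tsum_occProb_le (hp : ∀ x, ∑' y, p x y = 1)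
    (hrev : ∀ x y, w x * p x y = w y * p y x) (hw : ∀ x, w x ≠ ∞) (hw0 : w o ≠ 0) {v : ℕ → S}
    (hv : Function.Injective v) (hv0 : v 0 = o)
    (hR : ∑' k, (w (v k) * p (v k) (v (k + 1)))⁻¹ ≠ ∞) (y : S) :
    ∑' n, occProb p o n y ≤ 2 * (∑' k, (w (v k) * p (v k) (v (k + 1)))⁻¹) * w y := by
  set R := ∑' k, (w (v k) * p (v k) (v (k + 1)))⁻¹
  refine ENNReal.tsum_le_of_sum_range_le fun N => ?_
  refine (ENNReal.mul_le_mul_iff_right hw0 (hw o)).1 ?_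
  rw [Finset.mul_sum]
  simp only [← weight_mul_hitProb hrev]
  rw [← Finset.mul_sum]
  calc w y * green p o N y ≤ w y * (R * (2 * w o)) := by
        gcongr
        exact (green_le_green_self hp N y).trans (green_self_le hp hrev hw hv hv0 hR N)
    _ = _ := by ring

end ReversibleChain

namespace MottWalk

open ReversibleChain

/-! ### One-dimensional marginals of the jump chain, and Borel-Cantelli. -/

theorem chainLaw_zero (u : ℝ → ℝ → ℝ) (lam : ℝ) (ω : Env) :
    (chainLaw u lam ω).map (fun x => x 0) = Measure.dirac 0 := by
  have : (Measure.dirac (0 : ℤ)).map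
    (MeasurableEquiv.piUnique (fun _ : Finset.Iic 0 => ℤ)).symm =
      Measure.dirac (fun _ => 0) := by
    rw [Measure.map_dirac' (by fun_prop)]
    congr 1
  unfold chainLaw Kernel.trajMeasure
  rw [show (fun x : ℕ → ℤ => x 0) =
      (fun y : (_ : Finset.Iic 0) → ℤ => y ⟨0, Finset.mem_Iic.2 le_rfl⟩) ∘
        Preorder.frestrictLe (π := fun _ => ℤ) 0 from rfl,
    ← Measure.map_map (by fun_prop) (by fun_prop), Measure.map_comp _ _ (by fun_prop),
    Kernel.traj_map_frestrictLe, Kernel.partialTraj_self, Measure.id_comp, this,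
    Measure.map_dirac' (by fun_prop)]

theorem chainLaw_succ (u : ℝ → ℝ → ℝ) (lam : ℝ) (ω : Env) (n : ℕ) :
    (chainLaw u lam ω).map (fun x => x (n + 1)) =
      ((chainLaw u lam ω).map (fun x => x n)).bind (jumpKernel u lam ω) := by
  have h := congrArg Measure.snd (Kernel.map_frestrictLe_trajMeasure_compProd_eq_map_trajMeasure
    (X := fun _ => ℤ) (μ₀ := Measure.dirac (0 : ℤ)) (κ := fun n => (jumpKernel u lam ω).comap
      (fun h : (_ : Finset.Iic n) → ℤ => h ⟨n, Finset.mem_Iic.2 le_rfl⟩)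
      (measurable_pi_apply _)) (a := n))
  rw [Measure.snd_compProd, Measure.snd_map_prodMk (by fun_prop)] at h
  unfold chainLaw
  rw [← h]
  ext s hs
  rw [Measure.bind_apply hs (by fun_prop), Measure.bind_apply hs (by fun_prop),
    lintegral_map (Kernel.measurable_coe _ hs) (by fun_prop),
    lintegral_map (Kernel.measurable_coe _ hs) (by fun_prop)]
  rfl

theorem chainLaw_apply (u : ℝ → ℝ → ℝ) (lam : ℝ) (ω : Env) (n : ℕ) (y : ℤ) :
    chainLaw u lam ω {x | x n = y} = occProb (fun i j => jumpLaw u lam ω i j) 0 n y := by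
  induction n generalizing y with
  | zero =>
    have := congrArg (fun m => m {y}) (chainLaw_zero u lam ω)
    beta_reduce at this
    rw [Measure.map_apply (by fun_prop) (by simp)] at this
    rw [show {x : ℕ → ℤ | x 0 = y} = (fun x => x 0) ⁻¹' {y} from rfl, this]
    by_cases h : y = 0
    · simp [occProb, h]
    · simp [occProb, h, Ne.symm h]
  | succ n ih =>
    have := congrArg (fun m => m {y}) (chainLaw_succ u lam ω n)
    beta_reduce at this
    rw [Measure.map_apply (by fun_prop) (by simp), Measure.bind_apply (by simp) (by fun_prop),
      lintegral_countable'] at this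
    rw [show {x : ℕ → ℤ | x (n + 1) = y} = (fun x => x (n + 1)) ⁻¹' {y} from rfl, this]
    simp only [occProb]
    refine tsum_congr fun z => ?_
    rw [Measure.map_apply (by fun_prop) (by simp), ← ih, mul_comm]
    congr 1
    exact PMF.toMeasure_apply_singleton _ _ (by simp)

/-- If the expected number of visits to `(-∞, K]` is finite for all `K`, the chain goes to `∞`. -/
theorem ae_tendsto_chain {u : ℝ → ℝ → ℝ} {lam : ℝ} {ω : Env}
    (h : ∀ K : ℤ, ∑' y : Set.Iic K, ∑' n, occProb (fun i j => jumpLaw u lam ω i j) 0 n y ≠ ∞) :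
    ∀ᵐ x ∂(chainLaw u lam ω), Tendsto x atTop atTop := by
  have hK : ∀ K : ℤ, ∀ᵐ x ∂(chainLaw u lam ω), ∀ᶠ n in atTop, x n ∉ Set.Iic K := by
    intro K
    refine ae_eventually_notMem (s := fun n => {x : ℕ → ℤ | x n ∈ Set.Iic K}) ?_
    convert! h K using 1
    rw [ENNReal.tsum_comm]
    refine tsum_congr fun n => ?_
    simp only [← chainLaw_apply]
    rw [← measure_iUnion]
    · congr 1
      ext x
      simp
    · intro a b hab
      refine Set.disjoint_left.2 fun x hx hx' => hab (Subtype.ext ?_)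
      exact hx.symm.trans hx'
    · intro a
      exact measurableSet_eq_fun (by fun_prop) (by fun_prop)
  filter_upwards [ae_all_iff.2 hK] with x hx
  refine tendsto_atTop.2 fun K => ?_
  filter_upwards [hx K] with n hn
  exact (not_le.1 hn).le

/-! ### Exponential clocks and the jump count. -/

/-- The clocks have infinite total time. -/
theorem ae_tendsto_clock : ∀ᵐ e ∂clockLaw, (∀ n, 0 ≤ e n) ∧
    Tendsto (fun n => ∑ k ∈ Finset.range n, e k) atTop atTop := by
  have : IsProbabilityMeasure (expMeasure 1) := isProbabilityMeasure_expMeasure one_pos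
  have hlaw : ∀ n, clockLaw.map (fun e => e n) = expMeasure 1 := fun n =>
    Measure.infinitePi_map_eval (fun _ => expMeasure 1) n
  have hcdf : ∀ t, 0 ≤ t → expMeasure 1 (Set.Iic t) = ENNReal.ofReal (1 - Real.exp (-t)) := by
    intro t ht
    have := cdf_expMeasure_eq (r := 1) one_pos t
    rw [if_pos ht, one_mul] at this
    rw [← this, ofReal_cdf]
  have hnn : ∀ᵐ e ∂clockLaw, ∀ n, 0 ≤ e n := by
    refine ae_all_iff.2 fun n => ?_
    have h0 : ∀ᵐ t ∂expMeasure 1, 0 ≤ t := by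
      rw [ae_iff]
      refine measure_mono_null (t := Set.Iic 0) (fun t ht => (not_le.1 ht).le) ?_
      simp [hcdf 0 le_rfl]
    rw [← hlaw n] at h0
    exact ae_of_ae_map (measurable_pi_apply n).aemeasurable h0
  -- Second Borel-Cantelli lemma: infinitely many clocks exceed 1, so their sum diverges.
  have hio : ∀ᵐ e ∂clockLaw, ∃ᶠ n in atTop, 1 < e n := by
    have hms : ∀ n, MeasurableSet {e : ℕ → ℝ | 1 < e n} := fun n =>
      measurableSet_lt (by fun_prop) (by fun_prop)
    have hind : iIndepSet (fun n => {e : ℕ → ℝ | 1 < e n}) clockLaw := by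
      have := iIndepFun_infinitePi (P := fun _ : ℕ => expMeasure 1) (X := fun _ x => x)
        (fun _ => measurable_id)
      rw [iIndepSet_iff_meas_biInter hms]
      intro t
      exact this.measure_inter_preimage_eq_mul t (sets := fun _ => Set.Ioi 1)
        fun _ _ => measurableSet_Ioi
    have hsum : ∑' n, clockLaw {e : ℕ → ℝ | 1 < e n} = ∞ := by
      have : ∀ n, clockLaw {e : ℕ → ℝ | 1 < e n} = expMeasure 1 (Set.Ioi 1) := by
        intro n
        rw [← hlaw n, Measure.map_apply (by fun_prop) measurableSet_Ioi]
        rfl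
      simp only [this]
      refine ENNReal.tsum_const_eq_top_of_ne_zero fun h => ?_
      have h1 := prob_compl_eq_zero_iff (μ := expMeasure 1) (measurableSet_Iic (a := (1 : ℝ)))
      rw [Set.compl_Iic] at h1
      have h2 := h1.1 h
      rw [hcdf 1 zero_le_one, ENNReal.ofReal_eq_one] at h2
      linarith [Real.exp_pos (-1)]
    have := measure_limsup_eq_one hms hind hsum
    have hm : MeasurableSet (limsup (fun n => {e : ℕ → ℝ | 1 < e n}) atTop) :=
      MeasurableSet.measurableSet_limsup hms
    have hP : IsProbabilityMeasure clockLaw := by unfold clockLaw; infer_instance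
    have h3 := (mem_ae_iff_prob_eq_one hm).2 this
    filter_upwards [h3] with e he
    exact mem_limsup_iff_frequently_mem.1 he
  filter_upwards [hnn, hio] with e he hf
  refine ⟨he, ?_⟩
  rw [← not_summable_iff_tendsto_nat_atTop_of_nonneg he]
  intro hs
  exact hf ((hs.tendsto_atTop_zero.eventually (gt_mem_nhds one_pos)).mono
    fun n hn => not_lt.2 hn.le)

/-- Divergence of `T` keeps the set bounded; the `sSup` of an unbounded set of naturals would be 0.
-/
theorem tendsto_sSup_le_atTop {T : ℕ → ℝ} (hT : Tendsto T atTop atTop) :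
    Tendsto (fun t : ℝ => sSup {n : ℕ | T n ≤ t}) atTop atTop := by
  refine tendsto_atTop.2 fun n => ?_
  filter_upwards [eventually_ge_atTop (T n)] with t ht
  refine le_csSup ?_ ht
  obtain ⟨N, hN⟩ := eventually_atTop.1 (hT.eventually_gt_atTop t)
  exact ⟨N, fun m hm => not_lt.1 fun h => not_lt.2 hm (hN m h.le)⟩

theorem summable_exp_neg_mul_abs {a : ℝ} (ha : 0 < a) :
    Summable fun m : ℤ => Real.exp (-a * |(m : ℝ)|) := by
  have h : Summable fun n : ℕ => Real.exp (-a * n) := by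
    have := Real.summable_exp_nat_mul_iff.2 (neg_lt_zero.2 ha)
    simpa [mul_comm] using this
  refine Summable.of_nat_of_neg ?_ ?_ <;> simpa using h

theorem tsum_exp_neg_mul_abs_ne_top {a : ℝ} (ha : 0 < a) :
    ∑' m : ℤ, ENNReal.ofReal (Real.exp (-a * |(m : ℝ)|)) ≠ ∞ :=
  (summable_exp_neg_mul_abs ha).tsum_ofReal_ne_top

/-! ### Estimates in a fixed environment. -/

section Deterministic

variable {u : ℝ → ℝ → ℝ} {lam d C : ℝ} {ω : Env}

theorem mul_sub_le_point_sub (hgap : ∀ k, d ≤ gap ω k) {i j : ℤ} (hij : i ≤ j) :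
    d * (j - i) ≤ point ω j - point ω i := by
  induction j, hij using Int.leInduction with
  | base => simp
  | succ j _ ih =>
    have := point_add_one_sub ω j
    have := hgap j
    push_cast
    linarith

theorem mul_abs_sub_le_abs_point_sub (hgap : ∀ k, d ≤ gap ω k) (i j : ℤ) :
    d * |(j : ℝ) - i| ≤ |point ω j - point ω i| := by
  rcases le_total i j with h | h
  · rw [abs_of_nonneg (sub_nonneg.2 (Int.cast_le.2 h))]
    exact (mul_sub_le_point_sub hgap h).trans (le_abs_self _)
  · rw [abs_sub_comm, abs_sub_comm (point ω j), abs_of_nonneg (sub_nonneg.2 (Int.cast_le.2 h))]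
    exact (mul_sub_le_point_sub hgap h).trans (le_abs_self _)

/-- The bias costs at most the fraction λ < 1 of the exponential decay. -/
theorem rate_le (hgap : ∀ k, d ≤ gap ω k) (hu : ∀ a b, |u a b| ≤ C) (hlam0 : 0 < lam)
    (hlam1 : lam < 1) (i j : ℤ) :
    rate u lam ω i j ≤ Real.exp C * Real.exp (-((1 - lam) * d) * |((j - i : ℤ) : ℝ)|) := by
  unfold rate
  split_ifs with h
  · positivity
  · rw [← Real.exp_add]
    refine Real.exp_le_exp.2 ?_
    have h1 := mul_abs_sub_le_abs_point_sub hgap i j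
    have h2 := le_abs_self (point ω j - point ω i)
    have h3 := neg_abs_le (u (mark ω i) (mark ω j))
    have h4 := hu (mark ω i) (mark ω j)
    rw [abs_sub_comm (point ω i)]
    push_cast
    nlinarith [mul_le_mul_of_nonneg_left h1 (sub_nonneg.2 hlam1.le),
      mul_le_mul_of_nonneg_left h2 hlam0.le]

theorem totalRate_le (hgap : ∀ k, d ≤ gap ω k) (hu : ∀ a b, |u a b| ≤ C) (hlam0 : 0 < lam)
    (hlam1 : lam < 1) (i : ℤ) :
    totalRate u lam ω i ≤ ENNReal.ofReal (Real.exp C) *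
      ∑' m : ℤ, ENNReal.ofReal (Real.exp (-((1 - lam) * d) * |(m : ℝ)|)) := by
  rw [← (Equiv.subRight i).tsum_eq, ← ENNReal.tsum_mul_left]
  refine ENNReal.tsum_le_tsum fun j => ?_
  rw [← ENNReal.ofReal_mul (Real.exp_nonneg _)]
  exact ENNReal.ofReal_le_ofReal (rate_le hgap hu hlam0 hlam1 i j)

theorem totalRate_ne_top (hd : 0 < d) (hgap : ∀ k, d ≤ gap ω k) (hu : ∀ a b, |u a b| ≤ C)
    (hlam0 : 0 < lam) (hlam1 : lam < 1) (i : ℤ) : totalRate u lam ω i ≠ ∞ :=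
  ne_top_of_le_ne_top (ENNReal.mul_ne_top ENNReal.ofReal_ne_top
    (tsum_exp_neg_mul_abs_ne_top (mul_pos (sub_pos.2 hlam1) hd)))
    (totalRate_le hgap hu hlam0 hlam1 i)

theorem totalRate_ne_zero (u : ℝ → ℝ → ℝ) (lam : ℝ) (ω : Env) (i : ℤ) :
    totalRate u lam ω i ≠ 0 := by
  intro h
  have := ENNReal.tsum_eq_zero.1 h (i + 1)
  rw [ENNReal.ofReal_eq_zero, rate, if_neg (by omega)] at this
  exact absurd this (not_le.2 (Real.exp_pos _))

theorem jumpLaw_apply (h : ∀ i, totalRate u lam ω i ≠ ∞) (i j : ℤ) :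
    jumpLaw u lam ω i j = ENNReal.ofReal (rate u lam ω i j) * (totalRate u lam ω i)⁻¹ := by
  rw [jumpLaw, dif_pos ⟨totalRate_ne_zero u lam ω i, h i⟩]
  exact PMF.normalize_apply (f := fun j => ENNReal.ofReal (rate u lam ω i j)) _ _ j

/-- The reversible weight of the jump chain. -/
noncomputable def weight (u : ℝ → ℝ → ℝ) (lam : ℝ) (ω : Env) (i : ℤ) : ℝ≥0∞ :=
  ENNReal.ofReal (Real.exp (2 * lam * point ω i)) * totalRate u lam ω i

theorem weight_mul_jumpLaw (h : ∀ i, totalRate u lam ω i ≠ ∞) (i j : ℤ) :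
    weight u lam ω i * jumpLaw u lam ω i j =
      ENNReal.ofReal (Real.exp (2 * lam * point ω i) * rate u lam ω i j) := by
  rw [weight, jumpLaw_apply h, ENNReal.ofReal_mul (Real.exp_nonneg _), mul_assoc,
    mul_left_comm (totalRate u lam ω i), ENNReal.mul_inv_cancel (totalRate_ne_zero u lam ω i) (h i),
    mul_one]

theorem exp_mul_rate_comm (hsymm : ∀ a b, u a b = u b a) (i j : ℤ) :
    Real.exp (2 * lam * point ω i) * rate u lam ω i j =
      Real.exp (2 * lam * point ω j) * rate u lam ω j i := by
  unfold rate
  by_cases h : i = j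
  · simp [h]
  · rw [if_neg h, if_neg (Ne.symm h), ← Real.exp_add, ← Real.exp_add, abs_sub_comm, hsymm]
    ring_nf

/-- Total rates are bounded, and exp(2λx) decays geometrically to the left since gaps are at least
`d`. -/
theorem tsum_weight_Iic_ne_top (hd : 0 < d) (hgap : ∀ k, d ≤ gap ω k) (hu : ∀ a b, |u a b| ≤ C)
    (hlam0 : 0 < lam) (hlam1 : lam < 1) (K : ℤ) :
    ∑' y : Set.Iic K, weight u lam ω y ≠ ∞ := by
  set B := ENNReal.ofReal (Real.exp C) *
      ∑' m : ℤ, ENNReal.ofReal (Real.exp (-((1 - lam) * d) * |(m : ℝ)|))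
  have hB : B ≠ ∞ := ENNReal.mul_ne_top ENNReal.ofReal_ne_top
    (tsum_exp_neg_mul_abs_ne_top (mul_pos (sub_pos.2 hlam1) hd))
  have hS := tsum_exp_neg_mul_abs_ne_top (a := 2 * lam * d) (by positivity)
  refine ne_top_of_le_ne_top (ENNReal.mul_ne_top (ENNReal.mul_ne_top
    (ENNReal.ofReal_ne_top (r := Real.exp (2 * lam * point ω K))) hB) hS) ?_
  refine le_trans ?_ (mul_le_mul_right (ENNReal.tsum_comp_le_tsum_of_injective
    (f := fun y : Set.Iic K => K - (y : ℤ)) (fun a b hab => Subtype.ext (by simpa using hab)) _) _)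
  rw [← ENNReal.tsum_mul_left]
  refine ENNReal.tsum_le_tsum fun y => ?_
  have hy : (y : ℤ) ≤ K := y.2
  have hexp : Real.exp (2 * lam * point ω y) ≤ Real.exp (2 * lam * point ω K) *
      Real.exp (-(2 * lam * d) * |((K - (y : ℤ) : ℤ) : ℝ)|) := by
    rw [← Real.exp_add]
    refine Real.exp_le_exp.2 ?_
    have h1 := mul_sub_le_point_sub hgap hy
    push_cast
    rw [abs_of_nonneg (sub_nonneg.2 (Int.cast_le.2 hy))]
    nlinarith [mul_le_mul_of_nonneg_left h1 hlam0.le]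
  calc weight u lam ω y ≤ ENNReal.ofReal (Real.exp (2 * lam * point ω K) *
        Real.exp (-(2 * lam * d) * |((K - (y : ℤ) : ℤ) : ℝ)|)) * B :=
        mul_le_mul' (ENNReal.ofReal_le_ofReal hexp) (totalRate_le hgap hu hlam0 hlam1 y)
    _ = _ := by rw [ENNReal.ofReal_mul (Real.exp_nonneg _)]; ring

/-- The k-th resistance is exp(-2λx_k + (1-λ)Z_k + u). Half of the gain 2λdk absorbs the gap term,
leaving exp(C - λdk). -/
theorem resistance_ne_top (hd : 0 < d) (hgap : ∀ k, d ≤ gap ω k) (hu : ∀ a b, |u a b| ≤ C)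
    (hlam0 : 0 < lam) (hlam1 : lam < 1)
    (hsub : ∀ᶠ k : ℕ in atTop, (1 - lam) * gap ω k ≤ lam * d * k) :
    ∑' k : ℕ, (weight u lam ω k * jumpLaw u lam ω k ((k + 1 : ℕ) : ℤ))⁻¹ ≠ ∞ := by
  have hr := totalRate_ne_top hd hgap hu hlam0 hlam1
  have hval : ∀ k : ℕ, (weight u lam ω k * jumpLaw u lam ω k ((k + 1 : ℕ) : ℤ))⁻¹ =
      ENNReal.ofReal (Real.exp (-(2 * lam * point ω k) + (1 - lam) * gap ω k +
        u (mark ω k) (mark ω (k + 1)))) := by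
    intro k
    have hg := point_add_one_sub ω k
    have hgk := hgap k
    rw [weight_mul_jumpLaw hr, rate, if_neg (by simp), ← Real.exp_add,
      ← ENNReal.ofReal_inv_of_pos (Real.exp_pos _), ← Real.exp_neg]
    congr 2
    push_cast
    rw [abs_sub_comm, hg, abs_of_nonneg (hd.le.trans hgk)]
    ring
  simp only [hval]
  refine Summable.tsum_ofReal_ne_top ?_
  have hgeo : Summable fun k : ℕ => Real.exp C * Real.exp (k * (-(lam * d))) :=
    (Real.summable_exp_nat_mul_iff.2 (neg_lt_zero.2 (mul_pos hlam0 hd))).mul_left _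
  refine hgeo.of_norm_bounded_eventually_nat ?_
  filter_upwards [hsub] with k hk
  rw [Real.norm_of_nonneg (Real.exp_nonneg _), ← Real.exp_add]
  refine Real.exp_le_exp.2 ?_
  have h1 := mul_sub_le_point_sub hgap (Int.natCast_nonneg k)
  rw [point_zero] at h1
  push_cast at h1
  have h2 := (abs_le.1 (hu (mark ω k) (mark ω (k + 1)))).2
  nlinarith [mul_le_mul_of_nonneg_left h1 hlam0.le]

/-- The jump chain is transient to the right. -/
theorem ae_tendsto_chain_of_gap (hd : 0 < d) (hgap : ∀ k, d ≤ gap ω k)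
    (hu : ∀ a b, |u a b| ≤ C) (hsymm : ∀ a b, u a b = u b a) (hlam0 : 0 < lam) (hlam1 : lam < 1)
    (hsub : ∀ᶠ k : ℕ in atTop, (1 - lam) * gap ω k ≤ lam * d * k) :
    ∀ᵐ x ∂(chainLaw u lam ω), Tendsto x atTop atTop := by
  have hr := totalRate_ne_top hd hgap hu hlam0 hlam1
  have hp : ∀ i, ∑' j, jumpLaw u lam ω i j = 1 := fun i => PMF.tsum_coe _
  have hrev : ∀ i j, weight u lam ω i * jumpLaw u lam ω i j =
      weight u lam ω j * jumpLaw u lam ω j i := fun i j => by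
    rw [weight_mul_jumpLaw hr, weight_mul_jumpLaw hr, exp_mul_rate_comm hsymm]
  have hw : ∀ i, weight u lam ω i ≠ ∞ := fun i => ENNReal.mul_ne_top ENNReal.ofReal_ne_top (hr i)
  have hw0 : weight u lam ω 0 ≠ 0 := mul_ne_zero
    (ENNReal.ofReal_pos.2 (Real.exp_pos _)).ne' (totalRate_ne_zero u lam ω 0)
  have hR := resistance_ne_top hd hgap hu hlam0 hlam1 hsub
  refine ae_tendsto_chain fun K => ?_
  refine ne_top_of_le_ne_top ?_ (ENNReal.tsum_le_tsum fun y =>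
    tsum_occProb_le hp hrev hw hw0 (v := fun k : ℕ => (k : ℤ)) Nat.cast_injective
      Nat.cast_zero hR y)
  rw [ENNReal.tsum_mul_left]
  exact ENNReal.mul_ne_top (ENNReal.mul_ne_top (by simp) hR)
    (tsum_weight_Iic_ne_top hd hgap hu hlam0 hlam1 K)

theorem tendsto_point (hd : 0 < d) (hgap : ∀ k, d ≤ gap ω k) :
    Tendsto (point ω) atTop atTop := by
  have h : Tendsto (fun k : ℤ => d * (k : ℝ)) atTop atTop :=
    tendsto_intCast_atTop_atTop.const_mul_atTop hd
  refine tendsto_atTop_mono' _ ?_ h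
  filter_upwards [eventually_ge_atTop 0] with k hk
  simpa [point_zero] using mul_sub_le_point_sub hgap hk

/-- No explosion: each holding time is at least its clock divided by `B`. -/
theorem tendsto_jumpTime {B : ℝ≥0∞} (hB : B ≠ ∞) (hr : ∀ i, totalRate u lam ω i ≤ B)
    {p : (ℕ → ℤ) × (ℕ → ℝ)} (h0 : ∀ n, 0 ≤ p.2 n)
    (hp : Tendsto (fun n => ∑ k ∈ Finset.range n, p.2 k) atTop atTop) :
    Tendsto (jumpTime u lam ω p) atTop atTop := by
  have hB0 : 0 < B := (pos_iff_ne_zero.2 (totalRate_ne_zero u lam ω 0)).trans_le (hr 0)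
  refine tendsto_atTop_mono (fun n => ?_) (hp.atTop_div_const (ENNReal.toReal_pos hB0.ne' hB))
  rw [jumpTime, Finset.sum_div]
  refine Finset.sum_le_sum fun k _ => ?_
  have hk := hr (p.1 k)
  exact div_le_div_of_nonneg_left (h0 k)
    (ENNReal.toReal_pos (totalRate_ne_zero u lam ω _) (ne_top_of_le_ne_top hB hk))
    (ENNReal.toReal_mono hB hk)

theorem ae_tendsto_walk (hd : 0 < d) (hgap : ∀ k, d ≤ gap ω k)
    (hu : ∀ a b, |u a b| ≤ C) (hsymm : ∀ a b, u a b = u b a) (hlam0 : 0 < lam) (hlam1 : lam < 1)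
    (hsub : ∀ᶠ k : ℕ in atTop, (1 - lam) * gap ω k ≤ lam * d * k) :
    ∀ᵐ p ∂(quenchedLaw u lam ω), Tendsto (fun t : ℝ => walk u lam ω p t) atTop atTop := by
  have : IsProbabilityMeasure (chainLaw u lam ω) := by unfold chainLaw; infer_instance
  have : IsProbabilityMeasure clockLaw := by
    have : IsProbabilityMeasure (expMeasure 1) := isProbabilityMeasure_expMeasure one_pos
    unfold clockLaw; infer_instance
  have h1 := (Measure.quasiMeasurePreserving_fst (μ := chainLaw u lam ω) (ν := clockLaw)).ae
    (ae_tendsto_chain_of_gap hd hgap hu hsymm hlam0 hlam1 hsub)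
  have h2 := (Measure.quasiMeasurePreserving_snd (μ := chainLaw u lam ω) (ν := clockLaw)).ae
    ae_tendsto_clock
  unfold quenchedLaw
  filter_upwards [h1, h2] with p hp1 hp2
  have hT := tendsto_jumpTime (ENNReal.mul_ne_top ENNReal.ofReal_ne_top
    (tsum_exp_neg_mul_abs_ne_top (mul_pos (sub_pos.2 hlam1) hd)))
    (totalRate_le hgap hu hlam0 hlam1) hp2.1 hp2.2
  exact (tendsto_point hd hgap).comp (hp1.comp (tendsto_sSup_le_atTop hT))

end Deterministic

/-! ### Almost sure properties of the stationary environment. -/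

section Environment

variable {P : Measure Env}

theorem measurable_gap (k : ℤ) : Measurable fun ω : Env => gap ω k :=
  (measurable_pi_apply k).fst

theorem measure_gap_mem (hP : MeasurePreserving (shift 1) P P) (k : ℤ) {s : Set ℝ}
    (hs : MeasurableSet s) : P {ω | gap ω k ∈ s} = P {ω | gap ω 0 ∈ s} := by
  have step : ∀ k : ℤ, P {ω | gap ω (k + 1) ∈ s} = P {ω | gap ω k ∈ s} := fun k =>
    hP.measure_preimage (measurable_gap k hs).nullMeasurableSet
  induction k using Int.induction_on with
  | zero => rfl
  | succ k ih => rw [step, ih]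
  | pred k ih => rw [← ih, ← step, sub_add_cancel]

theorem ae_le_gap (hP : MeasurePreserving (shift 1) P P) {d : ℝ} (hd : ∀ᵐ ω ∂P, d ≤ gap ω 0) :
    ∀ᵐ ω ∂P, ∀ k, d ≤ gap ω k := by
  refine ae_all_iff.2 fun k => ?_
  rw [ae_iff] at hd ⊢
  have := measure_gap_mem hP k (measurableSet_Iio (a := d))
  simp only [Set.mem_Iio, not_le] at this hd ⊢
  rw [this, hd]

/-- Integrability makes P(Z_0 > εk) summable in k; stationarity and the first Borel-Cantelli lemma,
which needs no independence, conclude. -/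
theorem ae_eventually_gap_le [IsProbabilityMeasure P] (hP : MeasurePreserving (shift 1) P P)
    (hint : Integrable (fun ω => gap ω 0) P) {ε : ℝ} (hε : 0 < ε) :
    ∀ᵐ ω ∂P, ∀ᶠ k : ℕ in atTop, gap ω k ≤ ε * k := by
  let _ : MeasureSpace Env := ⟨P⟩
  have : IsProbabilityMeasure (volume : Measure Env) := ‹IsProbabilityMeasure P›
  have h := tsum_prob_mem_Ioi_lt_top (X := fun ω : Env => |gap ω 0| / ε) (hint.abs.div_const ε)
    fun ω => by positivity
  have h2 : ∑' k : ℕ, P {ω | gap ω k ∈ Set.Ioi (ε * k)} ≠ ∞ := by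
    refine ne_top_of_le_ne_top h.ne (ENNReal.tsum_le_tsum fun k => ?_)
    rw [measure_gap_mem hP k measurableSet_Ioi]
    refine measure_mono fun ω hω => ?_
    change ε * k < gap ω 0 at hω
    change (k : ℝ) < |gap ω 0| / ε
    rw [lt_div_iff₀ hε, mul_comm]
    exact hω.trans_le (le_abs_self _)
  filter_upwards [ae_eventually_notMem h2] with ω hω
  filter_upwards [hω] with k hk
  exact not_lt.1 hk

end Environment

end MottWalk

theorem mainTheorem7
    (P : Measure MottWalk.Env) [IsProbabilityMeasure P]
    (hA1 : Ergodic (MottWalk.shift 1) P)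
    (hA2 : Integrable (fun ω => MottWalk.gap ω 0) P)
    (hA3 : ∀ l : ℤ, l ≠ 0 → P {ω | ω = MottWalk.shift l ω} = 0)
    (hA4 : ∃ d : ℝ, 0 < d ∧ ∀ᵐ ω ∂P, d ≤ MottWalk.gap ω 0)
    (u : ℝ → ℝ → ℝ) (hu_bdd : ∃ C : ℝ, ∀ a b, |u a b| ≤ C) (hu_symm : ∀ a b, u a b = u b a)
    (lam : ℝ) (hlam0 : 0 < lam) (hlam1 : lam < 1) :
    ∀ᵐ ω ∂P, ∀ᵐ p ∂(MottWalk.quenchedLaw u lam ω),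
      Tendsto (fun t : ℝ => MottWalk.walk u lam ω p t) atTop atTop := by
  obtain ⟨d, hd, hgap⟩ := hA4
  obtain ⟨C, hC⟩ := hu_bdd
  have hl : 0 < 1 - lam := sub_pos.2 hlam1
  have hP := hA1.toMeasurePreserving
  -- The choice ε = λd/(1-λ) is exactly the gap growth that the resistance estimate tolerates.
  filter_upwards [MottWalk.ae_le_gap hP hgap,
    MottWalk.ae_eventually_gap_le hP hA2 (div_pos (mul_pos hlam0 hd) hl)] with ω h1 h2
  refine MottWalk.ae_tendsto_walk hd h1 hC hu_symm hlam0 hlam1 ?_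
  filter_upwards [h2] with k hk
  rw [div_mul_eq_mul_div, le_div_iff₀ hl] at hk
  linarith
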